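/- For real $r>1$ let $M(r)=\dfrac{(r-1)\,r^{1/(r-1)}}{e\log r}$, and let $M(1)=1=\lim_{r\to1}M(r)$ (all logarithms are natural). Let $b\in\mathbb{R}$, $s_l,s_r>0$, $c_s>0$, and put $s=\max\{s_l,s_r\}$. Let $p:\mathbb{R}\to[0,\infty)$ be a probability density that vanishes outside $[b-s_l,b+s_r]$ and is unimodal with mode $b$, that is, nondecreasing on $(-\infty,b]$ and nonincreasing on $[b,\infty)$. Suppose that $p$, as a function on the whole real line, is Lipschitz continuous with constant $c_s$: $$|p(x+y)-p(x)|\le c_s|y|\qquad\text{for all }x,y\in\mathbb{R}.$$ Let $X$ be a random variable with density $p$, let $m=\int_{-\infty}^{\infty}x\,p(x)\,dx$ be its mean, and let $h(p)=-\int_{-\infty}^{\infty}p(x)\log p(x)\,dx$ be its differential entropy (with $0\log 0=0$). Then $$\frac{e^{2h(p)}}{2\pi e}\;\le\;\operatorname{Var}(X)\;\le\;\frac{c_s s^2\,e^{c_s s^2}\,M\!\left(128\,(c_s s^2)^4\right)}{6}\,e^{2h(p)}-(m-b)^2 .$$ -/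

import Mathlib

open MeasureTheory ProbabilityTheory

/-- `p` is a probability density function on the real line (with respect to Lebesgue measure). -/
structure IsProbDensity (p : ℝ → ℝ) : Prop where
  nonneg : ∀ x, 0 ≤ p x
  integrable : Integrable p
  integral_eq_one : ∫ x, p x = 1

/-- `p` is unimodal with mode `b`: nondecreasing to the left of `b`, nonincreasing to the right.
The mode is not required to be the only maximum point. -/
structure IsUnimodalWithMode (p : ℝ → ℝ) (b : ℝ) : Prop where
  left : MonotoneOn p (Set.Iic b)
  right : AntitoneOn p (Set.Ici b)

/-- The differential entropy `h(p) = - ∫ p(x) log p(x) dx` (natural logarithm, `0 log 0 = 0`). -/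
noncomputable def diffEntropy (p : ℝ → ℝ) : ℝ :=
  -∫ x, p x * Real.log (p x)

/-- The mean `∫ x p(x) dx` of a density. -/
noncomputable def densityMean (p : ℝ → ℝ) : ℝ :=
  ∫ x, x * p x

/-- The constant `M(r) = (r - 1) r ^ (1 / (r - 1)) / (e log r)` for `r > 1`,
with `M(1) = 1`, the limit as `r → 1`. -/
noncomputable def ratioConst (r : ℝ) : ℝ :=
  if r = 1 then 1 else (r - 1) * r ^ (1 / (r - 1)) / (Real.exp 1 * Real.log r)

/-! The upper bound is crude and rests on comparing `p` with triangles of slope `±c_s`. Write `K =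
c_s * s ^ 2`. A triangle under the graph at any point has area at most 1, so `p ≤ √c_s` and `exp (2
h) ≥ 1 / c_s`; a triangle over the whole support has area at least 1, so `K ≥ 1`. The second moment
about `b` is at most `s ^ 2 = K / c_s`, so it suffices that `exp K * M (128 K ^ 4) ≥ 6` for `K ≥ 1`.
Passing from `b` to the mean subtracts `(m - b) ^ 2`. The lower bound is Gaussian maximum entropy.
-/

/-- A triangle with slopes `±c` over an interval of half-width `s` has area `c * s ^ 2`. -/
theorem integral_triangle (c s b : ℝ) (hs : 0 ≤ s) :
    ∫ x in (b - s)..(b + s), c * (s - |x - b|) = c * s ^ 2 := by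
  have hc : Continuous fun x : ℝ => c * (s - |x - b|) := by fun_prop
  rw [← intervalIntegral.integral_add_adjacent_intervals (hc.intervalIntegrable (b - s) b)
    (hc.intervalIntegrable b (b + s))]
  have h1 : ∫ x in (b - s)..b, c * (s - |x - b|) = c * s ^ 2 / 2 := by
    have : ∀ x ∈ Set.uIcc (b - s) b,
        HasDerivAt (fun x : ℝ => c * (s - b + x) ^ 2 / 2) (c * (s - b + x)) x := by
      intro x _
      have h := ((((hasDerivAt_id x).const_add (s - b)).pow 2).const_mul c).div_const 2
      exact h.congr_deriv (by simp; ring)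
    rw [intervalIntegral.integral_congr (g := fun x => c * (s - b + x)),
      intervalIntegral.integral_eq_sub_of_hasDerivAt this]
    · ring
    · exact Continuous.intervalIntegrable (by fun_prop) _ _
    · intro x hx
      rw [Set.uIcc_of_le (by linarith)] at hx
      simp only
      rw [abs_of_nonpos (by linarith [hx.2])]
      ring
  have h2 : ∫ x in b..(b + s), c * (s - |x - b|) = c * s ^ 2 / 2 := by
    have : ∀ x ∈ Set.uIcc b (b + s),
        HasDerivAt (fun x : ℝ => -(c * (s + b - x) ^ 2 / 2)) (c * (s + b - x)) x := by
      intro x _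
      have h := (((((hasDerivAt_id x).const_sub (s + b)).pow 2).const_mul c).div_const 2).neg
      exact h.congr_deriv (by simp; ring)
    rw [intervalIntegral.integral_congr (g := fun x => c * (s + b - x)),
      intervalIntegral.integral_eq_sub_of_hasDerivAt this]
    · ring
    · exact Continuous.intervalIntegrable (by fun_prop) _ _
    · intro x hx
      rw [Set.uIcc_of_le (by linarith)] at hx
      simp only
      rw [abs_of_nonneg (by linarith [hx.1])]
      ring
  rw [h1, h2]
  ring

/-- A Lipschitz density with constant `c` is bounded by `√c`. -/
theorem IsProbDensity.sq_le_of_lipschitz {p : ℝ → ℝ} (hp : IsProbDensity p) {c : ℝ} (hc : 0 < c)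
    (hLip : ∀ x y : ℝ, |p (x + y) - p x| ≤ c * |y|) (a : ℝ) : p a ^ 2 ≤ c := by
  -- The half-width `p a / c` is where the Lipschitz minorant `p a - c * |x - a|` reaches zero.
  have hs : 0 ≤ p a / c := div_nonneg (hp.nonneg a) hc.le
  have hle : a - p a / c ≤ a + p a / c := by linarith
  have h1 : ∫ x in (a - p a / c)..(a + p a / c), c * (p a / c - |x - a|) ≤
      ∫ x in (a - p a / c)..(a + p a / c), p x := by
    apply intervalIntegral.integral_mono_on hle
      (Continuous.intervalIntegrable (by fun_prop) _ _) hp.integrable.intervalIntegrable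
    intro x _
    have h := (abs_le.1 (hLip a (x - a))).1
    rw [add_sub_cancel] at h
    rw [mul_sub, mul_div_cancel₀ _ hc.ne']
    linarith
  have h2 : ∫ x in (a - p a / c)..(a + p a / c), p x ≤ 1 := by
    rw [intervalIntegral.integral_of_le hle, ← hp.integral_eq_one]
    exact setIntegral_le_integral hp.integrable (Filter.Eventually.of_forall hp.nonneg)
  rw [integral_triangle c _ a hs] at h1
  have h3 : c * (p a / c) ^ 2 = p a ^ 2 / c := by field_simp
  rw [h3] at h1
  have h4 := h1.trans h2
  rwa [div_le_one hc] at h4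

/-- A Lipschitz density supported in an interval of half-width `s` has `1 ≤ c * s ^ 2`. -/
theorem IsProbDensity.one_le_of_lipschitz {p : ℝ → ℝ} (hp : IsProbDensity p) {c s b : ℝ}
    (hs : 0 ≤ s) (hLip : ∀ x y : ℝ, |p (x + y) - p x| ≤ c * |y|)
    (hvan : ∀ x, s ≤ |x - b| → p x = 0) : 1 ≤ c * s ^ 2 := by
  have hle : b - s ≤ b + s := by linarith
  have hsub : Function.support p ⊆ Set.Ioc (b - s) (b + s) := by
    intro x hx
    have h : |x - b| < s := by
      by_contra h
      exact hx (hvan x (not_lt.1 h))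
    rw [abs_lt] at h
    constructor <;> linarith [h.1, h.2]
  rw [← hp.integral_eq_one, ← intervalIntegral.integral_eq_integral_of_support_subset hsub,
    ← integral_triangle c s b hs]
  apply intervalIntegral.integral_mono_on hle hp.integrable.intervalIntegrable
    (Continuous.intervalIntegrable (by fun_prop) _ _)
  intro x hx
  -- Compare with the endpoint of the support on the same side of `b` as `x`, where `p` is zero.
  rcases le_total b x with h | h
  · have h1 := (abs_le.1 (hLip x (b + s - x))).1
    rw [add_sub_cancel, hvan (b + s) (by simp [le_abs_self]),
      abs_of_nonneg (by linarith [hx.2] : 0 ≤ b + s - x)] at h1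
    rw [abs_of_nonneg (by linarith)]
    linarith
  · have h1 := (abs_le.1 (hLip x (b - s - x))).1
    rw [add_sub_cancel, hvan (b - s) (by simp [le_abs_self]),
      abs_of_nonpos (by linarith [hx.1] : b - s - x ≤ 0)] at h1
    rw [abs_of_nonpos (by linarith)]
    linarith

/-- A bound `p ^ 2 ≤ c` gives `1 / c ≤ exp (2 h(p))`. -/
theorem IsProbDensity.inv_le_exp_two_mul_diffEntropy {p : ℝ → ℝ} (hp : IsProbDensity p)
    (hint : Integrable fun x => p x * Real.log (p x)) {c : ℝ} (hc : 0 < c)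
    (hbd : ∀ x, p x ^ 2 ≤ c) : c⁻¹ ≤ Real.exp (2 * diffEntropy p) := by
  have h1 : ∫ x, p x * Real.log (p x) ≤ ∫ x, p x * (Real.log c / 2) := by
    apply integral_mono hint (hp.integrable.mul_const _)
    intro x
    rcases (hp.nonneg x).eq_or_lt with h | h
    · simp [← h]
    · refine mul_le_mul_of_nonneg_left ?_ h.le
      have h2 := Real.log_le_log (by positivity) (hbd x)
      rw [Real.log_pow] at h2
      push_cast at h2
      linarith
  rw [integral_mul_const, hp.integral_eq_one] at h1
  rw [← Real.log_le_iff_le_exp (by positivity), Real.log_inv, diffEntropy]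
  linarith

/-- The Gaussian upper bound for the differential entropy, with a free variance parameter. -/
theorem IsProbDensity.diffEntropy_le_gaussian {p : ℝ → ℝ} (hp : IsProbDensity p)
    (hint : Integrable fun x => p x * Real.log (p x)) (m : ℝ)
    (hint2 : Integrable fun x => (x - m) ^ 2 * p x) {v : ℝ} (hv : 0 < v) :
    diffEntropy p ≤ Real.log (2 * Real.pi * v) / 2 + (∫ x, (x - m) ^ 2 * p x) / (2 * v) := by
  lift v to NNReal using hv.le
  have hv' : v ≠ 0 := by
    rintro rfl
    simp at hv
  -- Gibbs' inequality: `log t ≤ t - 1` at `t = g / p`, with `g` the Gaussian density; the excess `g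
  -- - p` integrates to zero.
  have hpt : ∀ x, -(p x * Real.log (p x)) ≤ (Real.log (2 * Real.pi * v) / 2 * p x +
      (x - m) ^ 2 * p x / (2 * v)) + (gaussianPDFReal m v x - p x) := by
    intro x
    have hg := gaussianPDFReal_pos m v x hv'
    have hlog : Real.log (gaussianPDFReal m v x) =
        -(Real.log (2 * Real.pi * v) / 2) - (x - m) ^ 2 / (2 * v) := by
      rw [gaussianPDFReal, Real.log_mul (by positivity) (Real.exp_pos _).ne', Real.log_exp,
        Real.log_inv, Real.log_sqrt (by positivity)]
      ring
    rcases (hp.nonneg x).eq_or_lt with h | h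
    · simp [← h, hg.le]
    · have h1 := Real.log_le_sub_one_of_pos (div_pos hg h)
      rw [Real.log_div hg.ne' h.ne', hlog] at h1
      have h2 := mul_le_mul_of_nonneg_left h1 h.le
      have h3 : p x * (gaussianPDFReal m v x / p x - 1) = gaussianPDFReal m v x - p x := by
        field_simp
      rw [h3] at h2
      have h4 : p x * (-(Real.log (2 * Real.pi * v) / 2) - (x - m) ^ 2 / (2 * v)
          - Real.log (p x)) = -(Real.log (2 * Real.pi * v) / 2 * p x +
          (x - m) ^ 2 * p x / (2 * v)) - p x * Real.log (p x) := by ring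
      linarith
  have hi1 := hp.integrable.const_mul (Real.log (2 * Real.pi * v) / 2)
  have hi2 := hint2.div_const (2 * (v : ℝ))
  have hi3 := (integrable_gaussianPDFReal m v).sub hp.integrable
  have h := integral_mono hint.neg ((hi1.add hi2).add hi3) hpt
  have e1 := integral_add (hi1.add hi2) hi3
  have e2 := integral_add hi1 hi2
  have e3 := integral_sub (integrable_gaussianPDFReal m v) hp.integrable
  have e4 := integral_neg (μ := volume) fun x => p x * Real.log (p x)
  rw [integral_const_mul, integral_div, hp.integral_eq_one] at e2
  rw [integral_gaussianPDFReal_eq_one m hv', hp.integral_eq_one] at e3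
  simp only [Pi.add_apply, Pi.sub_apply, Pi.neg_apply] at h e1 e2 e3 e4
  rw [e1, e2, e3, e4] at h
  rw [diffEntropy]
  linarith

/-- The maximum entropy inequality: `exp (2 h(p)) / (2 π e)` is at most the second moment of `p`
around any point. -/
theorem IsProbDensity.exp_two_mul_diffEntropy_le {p : ℝ → ℝ} (hp : IsProbDensity p)
    (hint : Integrable fun x => p x * Real.log (p x)) (m : ℝ)
    (hint2 : Integrable fun x => (x - m) ^ 2 * p x) :
    Real.exp (2 * diffEntropy p) / (2 * Real.pi * Real.exp 1) ≤ ∫ x, (x - m) ^ 2 * p x := by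
  -- The variance of the Gaussian whose entropy equals that of `p`.
  set v := Real.exp (2 * diffEntropy p) / (2 * Real.pi * Real.exp 1) with hvdef
  have hv : 0 < v := by positivity
  have h := hp.diffEntropy_le_gaussian hint m hint2 hv
  have hlog : Real.log (2 * Real.pi * v) = 2 * diffEntropy p - 1 := by
    have : 2 * Real.pi * v = Real.exp (2 * diffEntropy p - 1) := by
      rw [hvdef, Real.exp_sub]
      field_simp
    rw [this, Real.log_exp]
  rw [hlog] at h
  have h1 : 1 / 2 ≤ (∫ x, (x - m) ^ 2 * p x) / (2 * v) := by linarith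
  rw [le_div_iff₀ (by positivity)] at h1
  linarith

/-- The factor `exp K ≥ e` cancels the `e` in the denominator of `M`, and the power of `r` is at
least 1, which leaves `6 log r ≤ r - 1`. -/
theorem six_le_exp_mul_ratioConst {K : ℝ} (hK : 1 ≤ K) :
    6 ≤ Real.exp K * ratioConst (128 * K ^ 4) := by
  have hK4 : 1 ≤ K ^ 4 := one_le_pow₀ hK
  set r := 128 * K ^ 4 with hr
  have hr128 : 128 ≤ r := by linarith
  have hlogpos : 0 < Real.log r := Real.log_pos (by linarith)
  have hsq : 11 ≤ √r := Real.le_sqrt_of_sq_le (by linarith)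
  have hss : √r * √r = r := Real.mul_self_sqrt (by linarith)
  have hlog : Real.log r ≤ 2 * (√r - 1) := by
    have h := Real.log_le_sub_one_of_pos (by linarith : 0 < √r)
    rw [Real.log_sqrt (by linarith)] at h
    linarith
  -- `12 (√r - 1) ≤ (√r + 1) (√r - 1)` because `√r ≥ 11`.
  have h6 : 6 * Real.log r ≤ r - 1 := by nlinarith
  have hpow : 1 ≤ r ^ (1 / (r - 1)) :=
    Real.one_le_rpow (by linarith) (div_nonneg zero_le_one (by linarith))
  have hexp : Real.exp 1 ≤ Real.exp K := Real.exp_le_exp.2 hK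
  rw [ratioConst, if_neg (by linarith), ← mul_div_assoc,
    le_div_iff₀ (mul_pos (Real.exp_pos 1) hlogpos)]
  calc 6 * (Real.exp 1 * Real.log r) = Real.exp 1 * (6 * Real.log r * 1) := by ring
    _ ≤ Real.exp K * ((r - 1) * r ^ (1 / (r - 1))) := by
      gcongr
      linarith

theorem mainTheorem3 {Ω : Type*} [MeasurableSpace Ω] (P : Measure Ω) [IsProbabilityMeasure P]
    (X : Ω → ℝ) (p : ℝ → ℝ) (b s_l s_r c_s : ℝ)
    (hs_l : 0 < s_l) (hs_r : 0 < s_r) (hc_s : 0 < c_s)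
    (hp : IsProbDensity p)
    (hsupp : Function.support p ⊆ Set.Icc (b - s_l) (b + s_r))
    (hmode : IsUnimodalWithMode p b)
    (hLip : ∀ x y : ℝ, |p (x + y) - p x| ≤ c_s * |y|)
    (hX : HasLaw X (volume.withDensity fun x => ENNReal.ofReal (p x)) P) :
    Real.exp (2 * diffEntropy p) / (2 * Real.pi * Real.exp 1) ≤ Var[X; P] ∧
    Var[X; P] ≤
      c_s * (max s_l s_r) ^ 2 * Real.exp (c_s * (max s_l s_r) ^ 2)
          * ratioConst (128 * (c_s * (max s_l s_r) ^ 2) ^ 4) / 6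
          * Real.exp (2 * diffEntropy p)
        - (densityMean p - b) ^ 2 := by
  set s := max s_l s_r with hs
  have hs_pos : 0 < s := lt_max_of_lt_left hs_l
  have hcont : Continuous p := by
    refine (LipschitzWith.of_dist_le_mul (K := c_s.toNNReal) fun x y => ?_).continuous
    have h := hLip y (x - y)
    rwa [add_sub_cancel, ← Real.dist_eq, ← Real.dist_eq, ← Real.coe_toNNReal _ hc_s.le] at h
  have hcs : HasCompactSupport p := HasCompactSupport.of_support_subset_isCompact isCompact_Icc hsupp
  have hmoment : ∀ f : ℝ → ℝ, Continuous f → Integrable fun x => f x * p x := fun f hf =>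
    (hf.mul hcont).integrable_of_hasCompactSupport hcs.mul_left
  have hint : Integrable fun x => p x * Real.log (p x) :=
    (Real.continuous_mul_log.comp hcont).integrable_of_hasCompactSupport hcs.mul_right
  have hvan' : ∀ x, s < |x - b| → p x = 0 := by
    intro x hx
    by_contra h
    have hmem := hsupp h
    have h1 : |x - b| ≤ s := abs_le.2
      ⟨by linarith [hmem.1, le_max_left s_l s_r], by linarith [hmem.2, le_max_right s_l s_r]⟩
    linarith
  -- Continuity on the whole line forces `p` to vanish at `b ± s` too, as the enclosing triangle
  -- requires.
  have hvan : ∀ x, s ≤ |x - b| → p x = 0 := by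
    have hcl : IsClosed {x | p x = 0} := isClosed_eq hcont continuous_const
    have hl : p (b - s) = 0 := by
      have : Set.Iio (b - s) ⊆ {x | p x = 0} := fun x hx => hvan' x (by
        have : x < b - s := hx
        rw [lt_abs]; right; linarith)
      have h := hcl.closure_subset_iff.2 this
      rw [closure_Iio] at h
      exact h Set.self_mem_Iic
    have hr : p (b + s) = 0 := by
      have : Set.Ioi (b + s) ⊆ {x | p x = 0} := fun x hx => hvan' x (by
        have : b + s < x := hx
        rw [lt_abs]; left; linarith)
      have h := hcl.closure_subset_iff.2 this
      rw [closure_Ioi] at h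
      exact h Set.self_mem_Ici
    intro x hx
    rcases hx.eq_or_lt with h | h
    · rcases (abs_eq hs_pos.le).1 h.symm with h | h
      · rwa [show x = b + s by linarith]
      · rwa [show x = b - s by linarith]
    · exact hvan' x h
  have hE : ∀ f : ℝ → ℝ, Continuous f → ∫ ω, f (X ω) ∂P = ∫ x, f x * p x := by
    intro f hf
    have h := hX.integral_comp (f := f) hf.aestronglyMeasurable
    simp only [Function.comp_def] at h
    rw [h, integral_withDensity_eq_integral_toReal_smul (by fun_prop) (by simp)]
    congr 1 with x
    rw [ENNReal.toReal_ofReal (hp.nonneg x), smul_eq_mul, mul_comm]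
  have hmean : ∫ ω, X ω ∂P = densityMean p := hE id continuous_id
  have hvar : Var[X; P] = ∫ x, (x - densityMean p) ^ 2 * p x := by
    rw [variance_eq_integral hX.aemeasurable, hmean]
    exact hE (fun x => (x - densityMean p) ^ 2) (by fun_prop)
  have hshift : ∫ x, (x - densityMean p) ^ 2 * p x =
      (∫ x, (x - b) ^ 2 * p x) - (densityMean p - b) ^ 2 := by
    set m := densityMean p with hm
    have hi1 := hmoment (fun x => (x - b) ^ 2) (by fun_prop)
    have hi2 := (hmoment id continuous_id).const_mul (2 * (b - m))
    have hi3 := hp.integrable.const_mul (m ^ 2 - b ^ 2)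
    have e : (fun x => (x - m) ^ 2 * p x) = fun x =>
        (x - b) ^ 2 * p x + 2 * (b - m) * (id x * p x) + (m ^ 2 - b ^ 2) * p x := by
      ext x
      simp only [id]
      ring
    have hm' : ∫ x, id x * p x = m := rfl
    rw [e, integral_add (by exact hi1.add hi2) hi3, integral_add hi1 hi2, integral_const_mul,
      integral_const_mul, hm', hp.integral_eq_one]
    ring
  refine ⟨hvar ▸ hp.exp_two_mul_diffEntropy_le hint _ (hmoment _ (by fun_prop)), ?_⟩
  rw [hvar, hshift]
  have hsecond : ∫ x, (x - b) ^ 2 * p x ≤ s ^ 2 := by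
    have h : ∫ x, (x - b) ^ 2 * p x ≤ ∫ x, s ^ 2 * p x := by
      refine integral_mono (hmoment (fun x => (x - b) ^ 2) (by fun_prop))
        (hp.integrable.const_mul _) fun x => ?_
      rcases le_or_gt s |x - b| with hx | hx
      · simp [hvan x hx]
      · exact mul_le_mul_of_nonneg_right
          (sq_le_sq' (by linarith [(abs_lt.1 hx).1]) (abs_lt.1 hx).2.le) (hp.nonneg x)
    rwa [integral_const_mul, hp.integral_eq_one, mul_one] at h
  have hent := hp.inv_le_exp_two_mul_diffEntropy hint hc_s (hp.sq_le_of_lipschitz hc_s hLip)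
  have h6 := six_le_exp_mul_ratioConst (hp.one_le_of_lipschitz hs_pos.le hLip hvan)
  have hfinal : s ^ 2 ≤ c_s * s ^ 2 * Real.exp (c_s * s ^ 2) * ratioConst (128 * (c_s * s ^ 2) ^ 4)
      / 6 * Real.exp (2 * diffEntropy p) := by
    calc s ^ 2 = c_s * s ^ 2 * 6 / 6 * c_s⁻¹ := by field_simp
      _ ≤ c_s * s ^ 2 * (Real.exp (c_s * s ^ 2) * ratioConst (128 * (c_s * s ^ 2) ^ 4)) / 6 *
          Real.exp (2 * diffEntropy p) := by gcongr
      _ = _ := by ring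
  linarith
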